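/- Conventions. For a locally compact Hausdorff space $K$, let $M(K)$ be the space of regular complex Borel measures on $K$ and $M^+(K)$ the set of finite non-negative regular Borel measures, equipped with the cone topology, i.e. the weak topology induced by the non-negative functions in $C_c(K)$ together with the constant function $1$. Let $p_x$ be the point mass at $x$, and let $C(K)$ be the space of bounded continuous functions $K\to\mathbb{C}$ with the supremum norm. A semitopological semihypergroup is a non-empty locally compact Hausdorff space $K$ with a bilinear associative product $*$ on $M(K)$ such that: $*$ maps $M^+(K)\times M^+(K)$ into $M^+(K)$ and is separately continuous there; for all $x,y\in K$ the measure $p_x*p_y$ is a probability measure with compact support; and $(x,y)\mapsto\operatorname{supp}(p_x*p_y)$ is continuous from $K\times K$ to the space of compact subsets of $K$ with the Michael (Vietoris) topology. For $f\in C(K)$ put $L_xf(y)=R_yf(x)=\int_K f\,d(p_x*p_y)$. The function $f$ is almost periodic if $\{L_xf:x\in K\}$ or, equivalently, $\{R_yf:y\in K\}$ is relatively compact in $C(K)$; $AP(K)$ is the space of such functions. $AP(K)$ is left amenable if there is a bounded linear functional $m$ on $AP(K)$ with $\|m\|=m(1)=1$ and $m(L_xf)=m(f)$ for all $x\in K$,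 $f\in AP(K)$. An action of $K$ on a subset $C$ of a Hausdorff locally convex space $E$ is a map $\pi:K\times C\to C$ such that $\pi(s,\pi(t,x))=\int_K\pi(\zeta,x)\,d(p_s*p_t)(\zeta)$ (weak integral, tested against the continuous linear functionals on $E$) for all $s,t\in K$, $x\in C$, and such that $\pi(e,x)=x$ for all $x\in C$ whenever $e$ is a two-sided identity of $K$ (i.e. $p_x*p_e=p_e*p_x=p_x$ for all $x$). When $C$ is compact and convex, $\pi$ is affine if each $\pi_s=\pi(s,\cdot)$ is affine, and equicontinuous if for each $x\in C$ and each neighbourhood $U$ of the diagonal in $C\times C$ there is a neighbourhood $V$ of the diagonal such that $(\pi(s,x),\pi(s,y))\in U$ for all $s\in K$ whenever $(x,y)\in V$. Theorem. Let $K$ be a semitopological semihypergroup. Then $AP(K)$ is left amenable if and only if for every non-empty compact convex subset $C$ of a Hausdorff locally convex space $E$, every separately continuous, equicontinuous, affine action $\pi$ of $K$ on $C$ has a common fixed point, i.e. there is $x_0\in C$ with $\pi(s,x_0)=x_0$ for all $s\in K$. (The equivalence holds with $E$ ranging over real spaces, and also with $E$ ranging over complex spaces.) -/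

import Mathlib

open MeasureTheory Topology Filter Set
open scoped BoundedContinuousFunction CompactlySupported NNReal ENNReal

universe u v

namespace SemiHyp

section Measures

/-- On a finite measure dominated by a finite regular measure, regularity is inherited. -/
theorem regular_of_le {X : Type*} [TopologicalSpace X] [T2Space X] [MeasurableSpace X]
    [BorelSpace X] {μ ν : Measure X} [IsFiniteMeasure μ] (hμ : μ.Regular) (h : ν ≤ μ) :
    ν.Regular := by
  have : IsFiniteMeasure ν := isFiniteMeasure_of_le μ h
  have : ν.InnerRegularCompactLTTop := by
    refine ⟨?_⟩
    rintro s ⟨hs, -⟩ r hr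
    obtain ⟨ε, hε, hlt⟩ : ∃ ε : ℝ≥0∞, ε ≠ 0 ∧ r + ε < ν s := by
      obtain ⟨ε, hε, h2⟩ := ENNReal.lt_iff_exists_add_pos_lt.1 hr
      exact ⟨ε, by simpa using hε.ne', h2⟩
    obtain ⟨F, hF, hFc, hlt2⟩ := hs.exists_isCompact_sdiff_lt (μ := μ) (measure_ne_top _ _) hε
    refine ⟨F, hF, hFc, ?_⟩
    have h1 : ν s ≤ ν F + ν (s \ F) := by
      calc ν s ≤ ν (F ∪ (s \ F)) := measure_mono (by intro x hx; by_cases x ∈ F <;> simp_all)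
        _ ≤ _ := measure_union_le _ _
    have h2 : ν (s \ F) ≤ ε := (h _).trans hlt2.le
    have hεt : ε ≠ ∞ := by
      rintro rfl
      simp at hlt
    by_contra hcon
    have : ν s ≤ r + ε := h1.trans (add_le_add (not_lt.1 hcon) h2)
    exact absurd hlt (not_lt.2 this)
  infer_instance

theorem regular_add {X : Type*} [TopologicalSpace X] [T2Space X] [MeasurableSpace X]
    [BorelSpace X] {μ ν : Measure X} [IsFiniteMeasure μ] [IsFiniteMeasure ν]
    (hμ : μ.Regular) (hν : ν.Regular) : (μ + ν).Regular := by
  infer_instance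

/-- The total variation of a complex measure is finite. -/
theorem isFiniteMeasure_variation {X : Type*} [MeasurableSpace X] (m : ComplexMeasure X) :
    IsFiniteMeasure m.variation := by
  have h : m.variation ≤
      (ComplexMeasure.re m).totalVariation + (ComplexMeasure.im m).totalVariation := by
    refine VectorMeasure.variation_le_of_forall_enorm_le fun E _ => ?_
    have h1 := SignedMeasure.enorm_le_totalVariation (ComplexMeasure.re m) E
    have h2 := SignedMeasure.enorm_le_totalVariation (ComplexMeasure.im m) E
    refine le_trans ?_ (add_le_add h1 h2)
    have : m E = (((ComplexMeasure.re m E : ℝ)) : ℂ)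
        + ((ComplexMeasure.im m E : ℝ) : ℂ) * Complex.I := by
      exact (Complex.re_add_im (m E)).symm
    rw [this]
    refine (enorm_add_le _ _).trans (le_of_eq ?_)
    simp [enorm_eq_nnnorm]
  exact isFiniteMeasure_of_le _ h

/-- `M(X)`: the complex vector space of regular complex Borel measures, that is, of the complex
measures whose total variation is a regular measure. -/
noncomputable def RegMeasure (X : Type*) [TopologicalSpace X] [T2Space X] [MeasurableSpace X]
    [BorelSpace X] : Submodule ℂ (ComplexMeasure X) where
  carrier := {m | m.variation.Regular}
  zero_mem' := by
    change (VectorMeasure.variation (0 : ComplexMeasure X)).Regular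
    rw [VectorMeasure.variation_zero]
    infer_instance
  add_mem' := by
    intro a b ha hb
    have := isFiniteMeasure_variation a
    have := isFiniteMeasure_variation b
    exact regular_of_le (regular_add ha hb) VectorMeasure.variation_add_le
  smul_mem' := by
    intro c a ha
    have : a.variation.Regular := ha
    change (VectorMeasure.variation (c • a)).Regular
    rw [VectorMeasure.variation_smul]
    infer_instance

/-- `M⁺(X)`: the finite non-negative regular Borel measures. -/
@[ext]
structure PosMeasure (X : Type*) [TopologicalSpace X] [MeasurableSpace X] where
  /-- The underlying Borel measure. -/
  toMeasure : Measure X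
  isFiniteMeasure : IsFiniteMeasure toMeasure
  regular : toMeasure.Regular

namespace PosMeasure

variable {X : Type*} [TopologicalSpace X] [MeasurableSpace X]

instance (μ : PosMeasure X) : IsFiniteMeasure μ.1 := μ.isFiniteMeasure

instance (μ : PosMeasure X) : μ.1.Regular := μ.regular

/-- The cone topology on `M⁺(X)`: the weak topology induced by the non-negative compactly supported
continuous functions together with the constant function `1`. -/
noncomputable instance coneTopology : TopologicalSpace (PosMeasure X) :=
  (⨅ f : C_c(X, ℝ≥0), TopologicalSpace.induced (fun μ : PosMeasure X => ∫ x, (f x : ℝ) ∂μ.1)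
    inferInstance) ⊓
  TopologicalSpace.induced (fun μ : PosMeasure X => μ.1.real univ) inferInstance

theorem continuous_integral_cc (f : C_c(X, ℝ≥0)) :
    Continuous fun μ : PosMeasure X => ∫ x, (f x : ℝ) ∂μ.1 := by
  rw [continuous_iff_le_induced]
  exact inf_le_left.trans (iInf_le _ f)

theorem continuous_mass : Continuous fun μ : PosMeasure X => μ.1.real univ := by
  rw [continuous_iff_le_induced]
  exact inf_le_right

/-- The inclusion of `M⁺(X)` into `M(X)`. -/
noncomputable def toReg [T2Space X] [BorelSpace X] (μ : PosMeasure X) : RegMeasure X :=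
  ⟨SignedMeasure.toComplexMeasure μ.1.toSignedMeasure 0, by
    refine regular_of_le μ.regular (VectorMeasure.variation_le_of_forall_enorm_le fun E hE => ?_)
    have : (SignedMeasure.toComplexMeasure μ.1.toSignedMeasure 0) E = ((μ.1.real E : ℝ) : ℂ) := by
      rw [SignedMeasure.toComplexMeasure_apply,
        Measure.toSignedMeasure_apply_measurable hE]
      rfl
    rw [this]
    rw [← ofReal_norm, Complex.norm_real, Real.norm_of_nonneg measureReal_nonneg,
      ofReal_measureReal]⟩

theorem toReg_injective [T2Space X] [BorelSpace X] :
    Function.Injective (toReg : PosMeasure X → RegMeasure X) := by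
  intro μ ν h
  have h1 := congrArg (fun m : RegMeasure X => ComplexMeasure.re m.1) h
  have h2 : μ.1.toSignedMeasure = ν.1.toSignedMeasure := h1
  exact PosMeasure.ext (Measure.toSignedMeasure_eq_toSignedMeasure_iff.1 h2)

/-- The point mass `p_x`. -/
noncomputable def point [T2Space X] [BorelSpace X] (x : X) : PosMeasure X :=
  ⟨Measure.dirac x, inferInstance, by
    have : (Measure.dirac x : Measure X).InnerRegularCompactLTTop := by
      refine ⟨?_⟩
      rintro s ⟨hs, -⟩ r hr
      by_cases hx : x ∈ s
      · refine ⟨{x}, by simpa using hx, isCompact_singleton, ?_⟩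
        rw [Measure.dirac_apply' _ hs] at hr
        simpa [hx] using hr
      · rw [Measure.dirac_apply' _ hs] at hr
        simp [hx] at hr
    infer_instance⟩

theorem continuous_point [T2Space X] [BorelSpace X] :
    Continuous (point : X → PosMeasure X) := by
  rw [continuous_iff_coinduced_le]
  refine le_inf (le_iInf fun f => ?_) ?_
  · rw [← continuous_iff_coinduced_le, continuous_induced_rng]
    have : ((fun μ : PosMeasure X => ∫ x, (f x : ℝ) ∂μ.1) ∘ point) = fun x => (f x : ℝ) := by
      funext x
      simp [point]
    rw [this]
    exact NNReal.continuous_coe.comp f.continuous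
  · rw [← continuous_iff_coinduced_le, continuous_induced_rng]
    have : ((fun μ : PosMeasure X => μ.1.real univ) ∘ point) = fun _ => (1 : ℝ) := by
      funext x
      simp [point]
    rw [this]
    exact continuous_const

theorem lowerSemicontinuous_integral [T2Space X] [LocallyCompactSpace X] [BorelSpace X]
    (f : X →ᵇ ℝ) (hf : ∀ x, 0 ≤ f x) :
    LowerSemicontinuous fun μ : PosMeasure X => ∫ x, f x ∂μ.1 := by
  intro μ₀ c hc
  obtain ⟨δ, hδ, hδc⟩ : ∃ δ : ℝ, 0 < δ ∧ c + ‖f‖ * δ < ∫ x, f x ∂μ₀.1 := by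
    have h1 : (0 : ℝ) < ‖f‖ + 1 := by positivity
    have h2 : 0 < (∫ x, f x ∂μ₀.1) - c := sub_pos.2 hc
    refine ⟨((∫ x, f x ∂μ₀.1) - c) / (‖f‖ + 1), by positivity, ?_⟩
    have : ‖f‖ * (((∫ x, f x ∂μ₀.1) - c) / (‖f‖ + 1)) < (∫ x, f x ∂μ₀.1) - c := by
      rw [mul_div_assoc', div_lt_iff₀ h1]
      nlinarith
    linarith
  obtain ⟨F, -, hF, hFδ⟩ := (MeasurableSet.univ (α := X)).exists_isCompact_sdiff_lt (μ := μ₀.1)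
    (measure_ne_top _ _) (ε := ENNReal.ofReal δ) (by simpa using hδ)
  obtain ⟨φ, hφ1, -, hφc, hφ⟩ := exists_continuous_one_zero_of_isCompact hF isClosed_empty
    (disjoint_empty F)
  let g : C_c(X, ℝ≥0) :=
    ⟨⟨fun x => (f x * φ x).toNNReal, by fun_prop⟩, by
      refine hφc.mono' ?_
      refine subset_trans ?_ subset_closure
      intro x hx
      simp only [Function.mem_support] at hx ⊢
      intro h0
      exact hx (by simp [h0])⟩
  have hg : ∀ x, (g x : ℝ) = f x * φ x := fun x =>
    Real.coe_toNNReal _ (mul_nonneg (hf x) (hφ x).1)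
  have hfi : ∀ μ : PosMeasure X, Integrable (fun x => f x) μ.1 := fun μ => f.integrable μ.1
  have hgi : ∀ μ : PosMeasure X, Integrable (fun x => (g x : ℝ)) μ.1 := by
    intro μ
    refine (hfi μ).mono' (by fun_prop) (Eventually.of_forall fun x => ?_)
    rw [hg, Real.norm_of_nonneg (mul_nonneg (hf x) (hφ x).1)]
    exact mul_le_of_le_one_right (hf x) (hφ x).2
  have key : c < ∫ x, (g x : ℝ) ∂μ₀.1 := by
    have hle : ∀ x, f x - (g x : ℝ) ≤ (Fᶜ).indicator (fun _ => ‖f‖) x := by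
      intro x
      rw [hg]
      by_cases hx : x ∈ F
      · have : φ x = 1 := hφ1 hx
        simp [hx, this]
      · have h1 : f x ≤ ‖f‖ := (le_abs_self _).trans (f.norm_coe_le_norm x)
        have h2 := mul_nonneg (hf x) (hφ x).1
        simp only [mem_compl_iff, hx, not_false_eq_true, indicator_of_mem]
        linarith
    have h1 : ∫ x, (f x - (g x : ℝ)) ∂μ₀.1 ≤ ∫ x, (Fᶜ).indicator (fun _ => ‖f‖) x ∂μ₀.1 := by
      refine integral_mono ((hfi μ₀).sub (hgi μ₀)) ?_ hle
      exact (integrable_const _).indicator hF.measurableSet.compl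
    rw [integral_sub (hfi μ₀) (hgi μ₀), integral_indicator hF.measurableSet.compl,
      setIntegral_const, smul_eq_mul] at h1
    have h2 : μ₀.1.real Fᶜ ≤ δ := by
      rw [← compl_eq_univ_sdiff] at hFδ
      exact ENNReal.toReal_le_of_le_ofReal hδ.le hFδ.le
    have h3 : μ₀.1.real Fᶜ * ‖f‖ ≤ δ * ‖f‖ := by gcongr
    nlinarith
  have hev := (continuous_integral_cc g).continuousAt.eventually (lt_mem_nhds key)
  filter_upwards [hev] with μ hμ
  refine hμ.trans_le (integral_mono (hgi μ) (hfi μ) fun x => ?_)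
  change (g x : ℝ) ≤ f x
  rw [hg]
  exact mul_le_of_le_one_right (hf x) (hφ x).2

theorem continuous_integral_real [T2Space X] [LocallyCompactSpace X] [BorelSpace X]
    (f : X →ᵇ ℝ) : Continuous fun μ : PosMeasure X => ∫ x, f x ∂μ.1 := by
  have hlsc : ∀ f : X →ᵇ ℝ, LowerSemicontinuous fun μ : PosMeasure X => ∫ x, f x ∂μ.1 := by
    intro f
    have h1 := lowerSemicontinuous_integral (f + BoundedContinuousFunction.const X ‖f‖) (by
      intro x
      have := neg_le_of_abs_le (f.norm_coe_le_norm x)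
      simp only [BoundedContinuousFunction.coe_add, Pi.add_apply,
        BoundedContinuousFunction.const_apply]
      linarith)
    have h2 : Continuous fun μ : PosMeasure X => -(μ.1.real univ * ‖f‖) :=
      (continuous_mass.mul continuous_const).neg
    have h3 := h1.add h2.lowerSemicontinuous
    refine (congrArg LowerSemicontinuous (funext fun μ => ?_)).mp h3
    have : ∫ x, (f + BoundedContinuousFunction.const X ‖f‖) x ∂μ.1
        = ∫ x, f x ∂μ.1 + ∫ _, ‖f‖ ∂μ.1 :=
      integral_add (f.integrable μ.1) (integrable_const _)
    rw [this, integral_const, smul_eq_mul]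
    ring
  rw [continuous_iff_lower_upperSemicontinuous]
  refine ⟨hlsc f, ?_⟩
  have h := hlsc (-f)
  intro μ c hc
  have := h μ (-c) (by simpa [integral_neg] using hc)
  filter_upwards [this] with ν hν
  simpa [integral_neg] using hν

/-- Integration against a bounded continuous function is continuous for the cone topology. -/
theorem continuous_integral [T2Space X] [LocallyCompactSpace X] [BorelSpace X]
    (f : X →ᵇ ℂ) : Continuous fun μ : PosMeasure X => ∫ x, f x ∂μ.1 := by
  let re : X →ᵇ ℝ := BoundedContinuousFunction.ofNormedAddCommGroup (fun x => (f x).re)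
    (by fun_prop) ‖f‖ fun x => (Complex.abs_re_le_norm _).trans (f.norm_coe_le_norm x)
  let im : X →ᵇ ℝ := BoundedContinuousFunction.ofNormedAddCommGroup (fun x => (f x).im)
    (by fun_prop) ‖f‖ fun x => (Complex.abs_im_le_norm _).trans (f.norm_coe_le_norm x)
  have h : (fun μ : PosMeasure X => ∫ x, f x ∂μ.1) =
      fun μ => ((∫ x, re x ∂μ.1 : ℝ) : ℂ) + ((∫ x, im x ∂μ.1 : ℝ) : ℂ) * Complex.I := by
    funext μ
    exact (integral_re_add_im (𝕜 := ℂ) (f.integrable μ.1)).symm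
  rw [h]
  exact (Complex.continuous_ofReal.comp (continuous_integral_real re)).add
    ((Complex.continuous_ofReal.comp (continuous_integral_real im)).mul continuous_const)

end PosMeasure

end Measures

theorem exists_finite_net {ι E : Type*} [PseudoMetricSpace E] {g : ι → E}
    (h : TotallyBounded (range g)) {ε : ℝ} (hε : 0 < ε) :
    ∃ u : Finset ι, ∀ i, ∃ j ∈ u, dist (g i) (g j) < ε := by
  classical
  obtain ⟨t, hts, htf, ht⟩ := totallyBounded_iff_subset.1 h _ (Metric.dist_mem_uniformity hε)
  choose k hk using fun y : t => hts y.2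
  have := htf.fintype
  refine ⟨Finset.univ.image k, fun i => ?_⟩
  have hi := ht ⟨i, rfl⟩
  simp only [mem_iUnion] at hi
  obtain ⟨y, hy, hd⟩ := hi
  refine ⟨k ⟨y, hy⟩, Finset.mem_image_of_mem _ (Finset.mem_univ _), ?_⟩
  rw [hk ⟨y, hy⟩]
  exact hd

/-- If the rows of a bounded function of two variables form a relatively compact set in the supremum
norm, then so do its columns. -/
theorem isCompact_closure_range_of_transpose {X Y : Type*} [TopologicalSpace X]
    [TopologicalSpace Y] {a : X → Y →ᵇ ℂ} {b : Y → X →ᵇ ℂ} (hab : ∀ x y, b y x = a x y)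
    (ha : IsCompact (closure (range a))) : IsCompact (closure (range b)) := by
  have hta : TotallyBounded (range a) := ha.totallyBounded.subset subset_closure
  refine TotallyBounded.isCompact_of_isClosed (TotallyBounded.closure ?_) isClosed_closure
  refine Metric.totallyBounded_iff.2 fun ε hε => ?_
  obtain ⟨u, hu⟩ := exists_finite_net hta (show 0 < ε / 4 by positivity)
  have htc : TotallyBounded (range fun (y : Y) (i : u) => a i y) := by
    have hc : IsCompact (Set.pi univ fun i : u => Metric.closedBall (0 : ℂ) ‖a i‖) :=
      isCompact_univ_pi fun i => isCompact_closedBall _ _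
    refine hc.totallyBounded.subset ?_
    rintro _ ⟨y, rfl⟩ i -
    simpa using (a i).norm_coe_le_norm y
  obtain ⟨v, hv⟩ := exists_finite_net htc (show 0 < ε / 4 by positivity)
  refine ⟨b '' v, v.finite_toSet.image _, ?_⟩
  rintro _ ⟨y, rfl⟩
  obtain ⟨z, hz, hyz⟩ := hv y
  refine mem_biUnion (mem_image_of_mem b hz) ?_
  rw [Metric.mem_ball]
  refine lt_of_le_of_lt ((BoundedContinuousFunction.dist_le (C := 3 * (ε / 4))
    (by positivity)).2 fun x => ?_) (by linarith)
  obtain ⟨i, hi, hxi⟩ := hu x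
  rw [hab, hab]
  have h1 : dist (a x y) (a i y) ≤ ε / 4 :=
    (BoundedContinuousFunction.dist_coe_le_dist y).trans hxi.le
  have h2 : dist (a x z) (a i z) ≤ ε / 4 :=
    (BoundedContinuousFunction.dist_coe_le_dist z).trans hxi.le
  have h3 : dist (a i y) (a i z) ≤ ε / 4 :=
    (dist_le_pi_dist (fun i : u => a i y) (fun i : u => a i z) ⟨i, hi⟩).trans hyz.le
  calc dist (a x y) (a x z)
      ≤ dist (a x y) (a i y) + dist (a i y) (a i z) + dist (a i z) (a x z) :=
        dist_triangle4 _ _ _ _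
    _ ≤ 3 * (ε / 4) := by rw [dist_comm (a i z)]; linarith

/-- A semitopological semihypergroup structure on a locally compact Hausdorff space `K`: an
associative algebra structure on `M(K)` that maps `M⁺(K) × M⁺(K)` to `M⁺(K)`, separately continuously
for the cone topology, such that all `p_x * p_y` are probability measures with compact support and
`(x, y) ↦ supp (p_x * p_y)` is continuous for the Michael (Vietoris) topology on the compact
subsets. -/
structure SemitopologicalSemihypergroup (K : Type*) [TopologicalSpace K] [T2Space K]
    [LocallyCompactSpace K] [MeasurableSpace K] [BorelSpace K] where
  /-- The convolution on `M(K)`. -/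
  conv : RegMeasure K →ₗ[ℂ] RegMeasure K →ₗ[ℂ] RegMeasure K
  conv_assoc : ∀ l m n, conv (conv l m) n = conv l (conv m n)
  /-- The restriction of the convolution to `M⁺(K)`, with values in `M⁺(K)`; it is determined by
  `conv` because `M⁺(K) → M(K)` is injective. -/
  convPos : PosMeasure K → PosMeasure K → PosMeasure K
  toReg_convPos : ∀ μ ν, (convPos μ ν).toReg = conv μ.toReg ν.toReg
  continuous_convPos_left : ∀ ω, Continuous fun μ => convPos ω μ
  continuous_convPos_right : ∀ ω, Continuous fun μ => convPos μ ω
  isProbabilityMeasure : ∀ x y, IsProbabilityMeasure (convPos (.point x) (.point y)).1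
  isCompact_support : ∀ x y, IsCompact (convPos (.point x) (.point y)).1.support
  continuous_support : Continuous fun q : K × K =>
    (⟨(convPos (.point q.1) (.point q.2)).1.support, isCompact_support q.1 q.2⟩ :
      TopologicalSpace.Compacts K)

namespace SemitopologicalSemihypergroup

variable {K : Type*} [TopologicalSpace K] [T2Space K] [LocallyCompactSpace K] [MeasurableSpace K]
  [BorelSpace K] (S : SemitopologicalSemihypergroup K)

/-- The probability measure `p_x * p_y`. -/
noncomputable def pp (x y : K) : Measure K := (S.convPos (.point x) (.point y)).1

instance (x y : K) : IsProbabilityMeasure (S.pp x y) := S.isProbabilityMeasure x y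

theorem norm_integral_pp_le (f : K →ᵇ ℂ) (x y : K) : ‖∫ z, f z ∂(S.pp x y)‖ ≤ ‖f‖ := by
  refine (norm_integral_le_of_norm_le_const
    (Eventually.of_forall fun z => f.norm_coe_le_norm z)).trans (le_of_eq ?_)
  simp

/-- The left translate `L_x f (y) = ∫ f d(p_x * p_y)` of a bounded continuous function. -/
noncomputable def leftTranslate (x : K) (f : K →ᵇ ℂ) : K →ᵇ ℂ :=
  BoundedContinuousFunction.ofNormedAddCommGroup (fun y => ∫ z, f z ∂(S.pp x y))
    ((PosMeasure.continuous_integral f).comp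
      ((S.continuous_convPos_left _).comp PosMeasure.continuous_point))
    ‖f‖ (fun y => S.norm_integral_pp_le f x y)

/-- The right translate `R_y f (x) = ∫ f d(p_x * p_y)` of a bounded continuous function. -/
noncomputable def rightTranslate (y : K) (f : K →ᵇ ℂ) : K →ᵇ ℂ :=
  BoundedContinuousFunction.ofNormedAddCommGroup (fun x => ∫ z, f z ∂(S.pp x y))
    ((PosMeasure.continuous_integral f).comp
      ((S.continuous_convPos_right _).comp PosMeasure.continuous_point))
    ‖f‖ (fun x => S.norm_integral_pp_le f x y)

/-- The left orbit of `f` is relatively compact in the supremum norm. -/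
def IsLeftAlmostPeriodic (f : K →ᵇ ℂ) : Prop :=
  IsCompact (closure (range fun x => S.leftTranslate x f))

/-- The right orbit of `f` is relatively compact in the supremum norm. -/
def IsRightAlmostPeriodic (f : K →ᵇ ℂ) : Prop :=
  IsCompact (closure (range fun y => S.rightTranslate y f))

theorem isLeftAlmostPeriodic_iff_isRightAlmostPeriodic (f : K →ᵇ ℂ) :
    S.IsLeftAlmostPeriodic f ↔ S.IsRightAlmostPeriodic f :=
  ⟨fun h => isCompact_closure_range_of_transpose (fun _ _ => rfl) h,
    fun h => isCompact_closure_range_of_transpose (fun _ _ => rfl) h⟩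

theorem leftTranslate_add (x : K) (f g : K →ᵇ ℂ) :
    S.leftTranslate x (f + g) = S.leftTranslate x f + S.leftTranslate x g := by
  ext y
  exact integral_add (f.integrable _) (g.integrable _)

theorem leftTranslate_smul (x : K) (c : ℂ) (f : K →ᵇ ℂ) :
    S.leftTranslate x (c • f) = c • S.leftTranslate x f := by
  ext y
  exact integral_smul c _

theorem leftTranslate_one (x : K) : S.leftTranslate x 1 = 1 := by
  ext y
  change ∫ _, (1 : ℂ) ∂(S.pp x y) = 1
  simp

/-- `AP(K)`: the space of (left or, equivalently, right) almost periodic functions. -/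
noncomputable def AP : Submodule ℂ (K →ᵇ ℂ) where
  carrier := {f | S.IsLeftAlmostPeriodic f ∨ S.IsRightAlmostPeriodic f}
  zero_mem' := by
    left
    have h : (range fun x => S.leftTranslate x (0 : K →ᵇ ℂ)) ⊆ {0} := by
      rintro _ ⟨x, rfl⟩
      have := S.leftTranslate_smul x 0 0
      simpa using this
    exact isCompact_singleton.of_isClosed_subset isClosed_closure
      (closure_minimal h isClosed_singleton)
  add_mem' := by
    intro f g hf hg
    rw [mem_ofPred_eq, ← isLeftAlmostPeriodic_iff_isRightAlmostPeriodic, or_self] at hf hg ⊢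
    have hc := IsCompact.add hf hg
    refine hc.of_isClosed_subset isClosed_closure (closure_minimal ?_ hc.isClosed)
    rintro _ ⟨x, rfl⟩
    refine ⟨_, subset_closure ⟨x, rfl⟩, _, subset_closure ⟨x, rfl⟩, ?_⟩
    exact (S.leftTranslate_add x f g).symm
  smul_mem' := by
    intro c f hf
    rw [mem_ofPred_eq, ← isLeftAlmostPeriodic_iff_isRightAlmostPeriodic, or_self] at hf ⊢
    have hc := IsCompact.smul c hf
    refine hc.of_isClosed_subset isClosed_closure (closure_minimal ?_ hc.isClosed)
    rintro _ ⟨x, rfl⟩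
    exact ⟨_, subset_closure ⟨x, rfl⟩, (S.leftTranslate_smul x c f).symm⟩

theorem one_mem_AP : (1 : K →ᵇ ℂ) ∈ S.AP := by
  left
  have h : (range fun x => S.leftTranslate x (1 : K →ᵇ ℂ)) ⊆ {1} := by
    rintro _ ⟨x, rfl⟩
    exact S.leftTranslate_one x
  exact isCompact_singleton.of_isClosed_subset isClosed_closure
    (closure_minimal h isClosed_singleton)

/-- A mean on `AP(K)`: a bounded linear functional `m` with `‖m‖ = 1 = m(1)`. -/
def IsMean (m : S.AP →L[ℂ] ℂ) : Prop :=
  ‖m‖ = 1 ∧ m ⟨1, S.one_mem_AP⟩ = 1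

/-- `m(L_x f) = m(f)` for all `x ∈ K` and `f ∈ AP(K)`. -/
def IsLeftInvariant (m : S.AP →L[ℂ] ℂ) : Prop :=
  ∀ (x : K) (f g : S.AP), (g : K →ᵇ ℂ) = S.leftTranslate x f → m g = m f

/-- `AP(K)` is left amenable: it admits a left invariant mean. -/
def LeftAmenableAP : Prop :=
  ∃ m : S.AP →L[ℂ] ℂ, S.IsMean m ∧ S.IsLeftInvariant m

/-- `e` is a two-sided identity. -/
def IsIdentity (e : K) : Prop :=
  ∀ x, S.pp x e = Measure.dirac x ∧ S.pp e x = Measure.dirac x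

end SemitopologicalSemihypergroup

/-- `v` is the weak (Pettis) integral of `f` with respect to `μ`: for every continuous linear
functional `φ`, the function `φ ∘ f` is integrable with integral `φ v`. -/
def HasWeakIntegral (𝕜 : Type*) [RCLike 𝕜] {X E : Type*} [MeasurableSpace X] [AddCommGroup E]
    [Module 𝕜 E] [TopologicalSpace E] (μ : Measure X) (f : X → E) (v : E) : Prop :=
  ∀ φ : E →L[𝕜] 𝕜, Integrable (fun x => φ (f x)) μ ∧ ∫ x, φ (f x) ∂μ = φ v

section Actions

variable {K : Type*} [TopologicalSpace K] [T2Space K] [LocallyCompactSpace K] [MeasurableSpace K]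
  [BorelSpace K]

/-- `π` is an action of the semihypergroup on the subset `C` of `E`:
`π(s, π(t, x)) = ∫ π(ζ, x) d(p_s * p_t)(ζ)`, and a two-sided identity, if there is one, acts as the
identity map. -/
structure IsAction (𝕜 : Type*) [RCLike 𝕜] (S : SemitopologicalSemihypergroup K) {E : Type*}
    [AddCommGroup E] [Module 𝕜 E] [TopologicalSpace E] {C : Set E} (π : K → C → C) : Prop where
  integral : ∀ (s t : K) (x : C),
    HasWeakIntegral 𝕜 (S.pp s t) (fun ζ => (π ζ x : E)) (π s (π t x) : E)
  identity : ∀ e, S.IsIdentity e → ∀ x, π e x = x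

/-- Separate continuity. -/
def IsSeparatelyContinuous {C : Type*} [TopologicalSpace C] (π : K → C → C) : Prop :=
  (∀ s, Continuous fun x => π s x) ∧ ∀ x, Continuous fun s => π s x

/-- Every `π_s` is affine on the (convex) set `C`. -/
def IsAffineAction {E : Type*} [AddCommGroup E] [Module ℝ E] {C : Set E} (π : K → C → C) : Prop :=
  ∀ (s : K) (x y z : C) (a b : ℝ), 0 ≤ a → 0 ≤ b → a + b = 1 →
    (z : E) = a • (x : E) + b • (y : E) → (π s z : E) = a • (π s x : E) + b • (π s y : E)

/-- Equicontinuity for the unique uniformity of a compact Hausdorff space `C`, whose entourages are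
the neighbourhoods of the diagonal. -/
def IsEquicontinuousAction {C : Type*} [TopologicalSpace C] (π : K → C → C) : Prop :=
  ∀ x : C, ∀ U ∈ 𝓝ˢ (diagonal C), ∃ V ∈ 𝓝ˢ (diagonal C),
    ∀ y, (x, y) ∈ V → ∀ s, (π s x, π s y) ∈ U

/-- Every separately continuous, equicontinuous, affine action of the semihypergroup on a nonempty
compact convex subset of a Hausdorff locally convex space over `𝕜` has a common fixed point. -/
def FixedPointProperty (𝕜 : Type) [RCLike 𝕜] {K : Type u} [TopologicalSpace K] [T2Space K]
    [LocallyCompactSpace K] [MeasurableSpace K] [BorelSpace K]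
    (S : SemitopologicalSemihypergroup K) : Prop :=
  ∀ (E : Type v) [AddCommGroup E] [Module 𝕜 E] [Module ℝ E] [IsScalarTower ℝ 𝕜 E]
    [TopologicalSpace E] [IsTopologicalAddGroup E] [ContinuousSMul 𝕜 E] [LocallyConvexSpace ℝ E]
    [T2Space E] (C : Set E), C.Nonempty → IsCompact C → Convex ℝ C →
    ∀ π : K → C → C, IsAction 𝕜 S π → IsSeparatelyContinuous π → IsEquicontinuousAction π →
      IsAffineAction π → ∃ x : C, ∀ s, π s x = x

end Actions

end SemiHyp

/-!
A mean on `AP(K)` is a weak* limit of convex combinations of point evaluations. Given an action on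
`C` and `x : C`, equicontinuity makes the functions `s ↦ re φ (π s x)` almost periodic, so a mean
`m` has a barycenter `y` on the orbit of `x`, which every affine continuous `π t` respects: the
functionals admitting such a `y` form a closed convex set containing the evaluations. If `m` is
left invariant, then `y` is fixed.

Conversely, `K` acts on the compact convex set of means by the duals of the left translations, and
a fixed point is a left invariant mean. This action is equicontinuous because the orbit of each
almost periodic function is totally bounded. That left translation satisfies the action identity
on functions reduces to point masses, whose cone is dense in `M⁺(K)`.
-/

namespace SemiHyp

/-! ### Separation in weak duals and the cone of positive measures -/

section HahnBanach

variable {𝕜 : Type*} [RCLike 𝕜]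

theorem exists_re_lt_of_notMem_closure_weakBilin {E F : Type*} [AddCommGroup E] [Module 𝕜 E]
    [Module ℝ E] [IsScalarTower ℝ 𝕜 E] [AddCommGroup F] [Module 𝕜 F] {B : E →ₗ[𝕜] F →ₗ[𝕜] 𝕜}
    {A : Set (WeakBilin B)} (hA : Convex ℝ A) {x : WeakBilin B} (hx : x ∉ closure A) :
    ∃ (y : F) (r : ℝ), (∀ a ∈ A, RCLike.re (B a y) < r) ∧ r < RCLike.re (B x y) := by
  have : ContinuousSMul ℝ (WeakBilin B) := IsScalarTower.continuousSMul 𝕜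
  obtain ⟨φ, r, hφA, hφx⟩ :=
    RCLike.geometric_hahn_banach_closed_point (𝕜 := 𝕜) hA.closure isClosed_closure hx
  obtain ⟨y, rfl⟩ := LinearMap.dualEmbedding_surjective B φ
  exact ⟨y, r, fun a ha => hφA a (subset_closure ha), hφx⟩

theorem exists_re_lt_of_notMem_closure_weakDual {V : Type*} [AddCommGroup V] [Module 𝕜 V]
    [TopologicalSpace V] {A : Set (WeakDual 𝕜 V)} (hA : Convex ℝ A) {φ : WeakDual 𝕜 V}
    (hφ : φ ∉ closure A) :
    ∃ (v : V) (r : ℝ), (∀ ψ ∈ A, RCLike.re (ψ v) < r) ∧ r < RCLike.re (φ v) :=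
  exists_re_lt_of_notMem_closure_weakBilin (B := topDualPairing 𝕜 V) hA hφ

end HahnBanach

namespace PosMeasure

theorem toMeasure_injective {X : Type*} [TopologicalSpace X] [MeasurableSpace X] :
    Function.Injective (toMeasure : PosMeasure X → Measure X) :=
  fun _ _ => PosMeasure.ext

section Cone

variable {X : Type*} [TopologicalSpace X] [T2Space X] [MeasurableSpace X] [BorelSpace X]

noncomputable instance : Zero (PosMeasure X) := ⟨⟨0, inferInstance, inferInstance⟩⟩

noncomputable instance : Add (PosMeasure X) :=
  ⟨fun μ ν => ⟨μ.1 + ν.1, inferInstance, inferInstance⟩⟩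

noncomputable instance : SMul ℝ≥0 (PosMeasure X) :=
  ⟨fun c μ => ⟨c • μ.1, inferInstance, inferInstance⟩⟩

noncomputable instance : SMul ℕ (PosMeasure X) := ⟨fun n μ => (n : ℝ≥0) • μ⟩

noncomputable instance : AddCommMonoid (PosMeasure X) :=
  toMeasure_injective.addCommMonoid _ rfl (fun _ _ => rfl) fun μ n => by
    change (n : ℝ≥0) • μ.1 = n • μ.1
    exact Nat.cast_smul_eq_nsmul _ _ _

noncomputable instance : Module ℝ≥0 (PosMeasure X) :=
  toMeasure_injective.module ℝ≥0 ⟨⟨toMeasure, rfl⟩, fun _ _ => rfl⟩ fun _ _ => rfl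

/-- Integration of a bounded continuous function, as a linear functional on the cone `M⁺(X)`. -/
noncomputable def integralₗ {F : Type*} [NormedAddCommGroup F] [NormedSpace ℝ F]
    [SecondCountableTopology F] [MeasurableSpace F] [BorelSpace F] (f : X →ᵇ F) :
    PosMeasure X →ₗ[ℝ≥0] F where
  toFun μ := ∫ x, f x ∂μ.1
  map_add' μ ν := integral_add_measure (f.integrable μ.1) (f.integrable ν.1)
  map_smul' c _ := integral_smul_nnreal_measure f c

theorem integralₗ_point {F : Type*} [NormedAddCommGroup F] [NormedSpace ℝ F] [CompleteSpace F]
    [SecondCountableTopology F] [MeasurableSpace F] [BorelSpace F] (f : X →ᵇ F) (x : X) :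
    integralₗ f (point x) = f x :=
  integral_dirac _ _

theorem toReg_apply (μ : PosMeasure X) {s : Set X} (hs : MeasurableSet s) :
    μ.toReg.1 s = (μ.1.real s : ℂ) := by
  change (SignedMeasure.toComplexMeasure μ.1.toSignedMeasure 0) s = _
  rw [SignedMeasure.toComplexMeasure_apply, Measure.toSignedMeasure_apply_measurable hs]
  rfl

theorem toReg_add (μ ν : PosMeasure X) : (μ + ν).toReg = μ.toReg + ν.toReg := by
  refine Subtype.ext (VectorMeasure.ext fun s hs => ?_)
  change (μ + ν).toReg.1 s = μ.toReg.1 s + ν.toReg.1 s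
  rw [toReg_apply _ hs, toReg_apply _ hs, toReg_apply _ hs, ← Complex.ofReal_add]
  exact congrArg _ measureReal_add_apply

theorem toReg_smul (c : ℝ≥0) (μ : PosMeasure X) : (c • μ).toReg = (c : ℂ) • μ.toReg := by
  refine Subtype.ext (VectorMeasure.ext fun s hs => ?_)
  change (c • μ).toReg.1 s = (c : ℂ) * μ.toReg.1 s
  rw [toReg_apply _ hs, toReg_apply _ hs, ← Complex.ofReal_mul]
  exact congrArg _ (measureReal_nnreal_smul_apply c)

/-- Integration against `μ`, as an element of the weak dual of the bounded continuous real
functions. -/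
noncomputable def integralFunctional (μ : PosMeasure X) : WeakDual ℝ (X →ᵇ ℝ) :=
  show (X →ᵇ ℝ) →L[ℝ] ℝ from LinearMap.mkContinuous
    ({ toFun := fun f => ∫ x, f x ∂μ.1
       map_add' := fun f g => integral_add (f.integrable μ.1) (g.integrable μ.1)
       map_smul' := fun c f => integral_const_mul c f } : (X →ᵇ ℝ) →ₗ[ℝ] ℝ)
    (μ.1.real univ) fun f => f.norm_integral_le_mul_norm μ.1

theorem isInducing_integralFunctional [LocallyCompactSpace X] :
    IsInducing (integralFunctional (X := X)) := by
  have hcont : Continuous (integralFunctional (X := X)) :=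
    WeakDual.continuous_of_continuous_eval continuous_integral_real
  have heval (f : X →ᵇ ℝ) :
      TopologicalSpace.induced (integralFunctional (X := X)) inferInstance ≤
        TopologicalSpace.induced (fun μ : PosMeasure X => ∫ x, f x ∂μ.1) inferInstance :=
    (induced_mono (continuous_iff_le_induced.1
      (WeakDual.eval_continuous (𝕜 := ℝ) (E := X →ᵇ ℝ) f))).trans_eq induced_compose
  refine ⟨le_antisymm hcont.le_induced (le_inf (le_iInf fun f => ?_) ?_)⟩
  · have hf : HasCompactSupport fun x => (f x : ℝ) :=
      f.hasCompactSupport.comp_left NNReal.coe_zero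
    have hfc : Continuous fun x => (f x : ℝ) := NNReal.continuous_coe.comp f.continuous
    obtain ⟨C, hC⟩ := hf.exists_bound_of_continuous hfc
    exact heval (.ofNormedAddCommGroup _ hfc C hC)
  · simpa using heval 1

theorem convex_integralFunctional_image (P : Submodule ℝ≥0 (PosMeasure X)) :
    Convex ℝ (integralFunctional '' (P : Set (PosMeasure X))) := by
  rintro _ ⟨ν, hν, rfl⟩ _ ⟨ρ, hρ, rfl⟩ a b ha hb -
  lift a to ℝ≥0 using ha
  lift b to ℝ≥0 using hb
  refine ⟨a • ν + b • ρ, add_mem (P.smul_mem a hν) (P.smul_mem b hρ),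
    DFunLike.ext _ _ fun f => ?_⟩
  change integralₗ f (a • ν + b • ρ) = a • integralₗ f ν + b • integralₗ f ρ
  rw [map_add, map_smul, map_smul]

theorem dense_span_range_point [LocallyCompactSpace X] :
    Dense (Submodule.span ℝ≥0 (range (point : X → PosMeasure X)) : Set (PosMeasure X)) := by
  intro μ
  rw [isInducing_integralFunctional.closure_eq_preimage_closure_image, mem_preimage]
  by_contra hμ
  obtain ⟨f, r, hlt, hμr⟩ :=
    exists_re_lt_of_notMem_closure_weakDual (convex_integralFunctional_image _) hμ
  have hspan (ν) (hν : ν ∈ Submodule.span ℝ≥0 (range (point : X → PosMeasure X))) :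
      integralₗ f ν < r := hlt _ ⟨ν, hν, rfl⟩
  have hr : 0 < r := (map_zero (integralₗ f)).symm.trans_lt (hspan 0 (zero_mem _))
  have hf (x : X) : f x ≤ 0 := by
    by_contra! hpos
    have hlt := hspan _ (Submodule.smul_mem _ (r / f x).toNNReal (Submodule.subset_span ⟨x, rfl⟩))
    rw [map_smul, NNReal.smul_def, Real.coe_toNNReal _ (by positivity), integralₗ_point,
      smul_eq_mul, div_mul_cancel₀ _ hpos.ne'] at hlt
    exact lt_irrefl _ hlt
  exact (hr.trans hμr).not_ge (integral_nonpos hf)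

theorem linearMap_ext_point [LocallyCompactSpace X] {F : Type*} [AddCommMonoid F] [Module ℝ≥0 F]
    [TopologicalSpace F] [T2Space F] {T₁ T₂ : PosMeasure X →ₗ[ℝ≥0] F} (h₁ : Continuous T₁)
    (h₂ : Continuous T₂) (h : ∀ x, T₁ (point x) = T₂ (point x)) : T₁ = T₂ := by
  have hspan : EqOn T₁ T₂ (Submodule.span ℝ≥0 (range (point : X → PosMeasure X))) :=
    LinearMap.eqOn_span (by rintro _ ⟨x, rfl⟩; exact h x)
  exact DFunLike.coe_injective (h₁.ext_on dense_span_range_point h₂ hspan)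

end Cone

end PosMeasure

/-! ### Translations of almost periodic functions -/

namespace SemitopologicalSemihypergroup

open PosMeasure

variable {K : Type*} [TopologicalSpace K] [T2Space K] [LocallyCompactSpace K] [MeasurableSpace K]
  [BorelSpace K] (S : SemitopologicalSemihypergroup K)

theorem convPos_assoc (μ ν ρ : PosMeasure K) :
    S.convPos (S.convPos μ ν) ρ = S.convPos μ (S.convPos ν ρ) := by
  apply toReg_injective
  simp only [S.toReg_convPos, S.conv_assoc]

/-- The convolution of `M⁺(K)`, as an `ℝ≥0`-bilinear map. -/
noncomputable def convPosₗ : PosMeasure K →ₗ[ℝ≥0] PosMeasure K →ₗ[ℝ≥0] PosMeasure K :=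
  LinearMap.mk₂ ℝ≥0 S.convPos
    (fun μ₁ μ₂ ν => toReg_injective <| by
      simp only [toReg_add, S.toReg_convPos, map_add, LinearMap.add_apply])
    (fun c μ ν => toReg_injective <| by
      simp only [toReg_smul, S.toReg_convPos, map_smul, LinearMap.smul_apply])
    (fun μ ν₁ ν₂ => toReg_injective <| by simp only [toReg_add, S.toReg_convPos, map_add])
    (fun c μ ν => toReg_injective <| by simp only [toReg_smul, S.toReg_convPos, map_smul])

theorem integral_convPos_point_left (s : K) (f : K →ᵇ ℂ) (μ : PosMeasure K) :
    ∫ z, f z ∂(S.convPos (point s) μ).1 = ∫ z, S.leftTranslate s f z ∂μ.1 := by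
  have h : integralₗ f ∘ₗ S.convPosₗ (point s) = integralₗ (S.leftTranslate s f) :=
    linearMap_ext_point ((continuous_integral f).comp (S.continuous_convPos_left _))
      (continuous_integral _) fun x => (integralₗ_point (S.leftTranslate s f) x).symm
  exact LinearMap.congr_fun h μ

theorem integral_convPos_point_right (s : K) (f : K →ᵇ ℂ) (μ : PosMeasure K) :
    ∫ z, f z ∂(S.convPos μ (point s)).1 = ∫ z, S.rightTranslate s f z ∂μ.1 := by
  have h : integralₗ f ∘ₗ S.convPosₗ.flip (point s) = integralₗ (S.rightTranslate s f) :=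
    linearMap_ext_point ((continuous_integral f).comp (S.continuous_convPos_right _))
      (continuous_integral _) fun x => (integralₗ_point (S.rightTranslate s f) x).symm
  exact LinearMap.congr_fun h μ

theorem leftTranslate_leftTranslate_apply (s t y : K) (f : K →ᵇ ℂ) :
    S.leftTranslate t (S.leftTranslate s f) y = ∫ z, S.leftTranslate z f y ∂(S.pp s t) :=
  calc ∫ z, S.leftTranslate s f z ∂(S.convPos (point t) (point y)).1
      = ∫ z, f z ∂(S.convPos (point s) (S.convPos (point t) (point y))).1 :=
        (S.integral_convPos_point_left s f _).symm
    _ = ∫ z, f z ∂(S.convPos (S.convPos (point s) (point t)) (point y)).1 := by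
        rw [convPos_assoc]
    _ = ∫ z, S.rightTranslate y f z ∂(S.convPos (point s) (point t)).1 :=
        S.integral_convPos_point_right y f _

theorem rightTranslate_leftTranslate (s y : K) (f : K →ᵇ ℂ) :
    S.rightTranslate y (S.leftTranslate s f) = S.leftTranslate s (S.rightTranslate y f) := by
  ext t
  exact S.leftTranslate_leftTranslate_apply s t y f

theorem mem_AP_iff_left {f : K →ᵇ ℂ} : f ∈ S.AP ↔ S.IsLeftAlmostPeriodic f := by
  change _ ∨ _ ↔ _
  rw [← isLeftAlmostPeriodic_iff_isRightAlmostPeriodic, or_self]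

theorem mem_AP_iff_right {f : K →ᵇ ℂ} : f ∈ S.AP ↔ S.IsRightAlmostPeriodic f := by
  rw [mem_AP_iff_left, isLeftAlmostPeriodic_iff_isRightAlmostPeriodic]

theorem norm_leftTranslate_le (x : K) (f : K →ᵇ ℂ) : ‖S.leftTranslate x f‖ ≤ ‖f‖ :=
  BoundedContinuousFunction.norm_ofNormedAddCommGroup_le _ (norm_nonneg _) _

/-- Left translation by `x`, as a bounded operator on the bounded continuous functions. -/
noncomputable def leftTranslateL (x : K) : (K →ᵇ ℂ) →L[ℂ] (K →ᵇ ℂ) :=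
  LinearMap.mkContinuous
    { toFun := S.leftTranslate x
      map_add' := S.leftTranslate_add x
      map_smul' := S.leftTranslate_smul x }
    1 fun f => (S.norm_leftTranslate_le x f).trans_eq (one_mul _).symm

theorem leftTranslate_mem_AP (s : K) {f : K →ᵇ ℂ} (hf : f ∈ S.AP) :
    S.leftTranslate s f ∈ S.AP := by
  rw [mem_AP_iff_right] at hf ⊢
  have hc := IsCompact.image hf (S.leftTranslateL s).continuous
  refine hc.of_isClosed_subset isClosed_closure (closure_minimal ?_ hc.isClosed)
  rintro _ ⟨y, rfl⟩
  exact ⟨_, subset_closure ⟨y, rfl⟩, (S.rightTranslate_leftTranslate s y f).symm⟩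

/-- Left translation by `s`, as a bounded operator on `AP(K)`. -/
noncomputable def translateAP (s : K) : S.AP →L[ℂ] S.AP :=
  (S.leftTranslateL s).restrict fun _ => S.leftTranslate_mem_AP s

theorem continuous_translateAP_apply (f : S.AP) : Continuous fun s => S.translateAP s f := by
  -- On the relatively compact orbit of `f` the uniform topology is that of pointwise convergence.
  let O := closure (range fun s => S.leftTranslate s f)
  have : CompactSpace O := isCompact_iff_compactSpace.1 (S.mem_AP_iff_left.1 f.2)
  have hO : IsClosedEmbedding fun h : O => ((h : K →ᵇ ℂ) : K → ℂ) :=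
    (BoundedContinuousFunction.continuous_coe.comp continuous_subtype_val).isClosedEmbedding
      (DFunLike.coe_injective.comp Subtype.val_injective)
  have h : Continuous fun s => (⟨S.leftTranslate s f, subset_closure ⟨s, rfl⟩⟩ : O) :=
    hO.continuous_iff.2 (continuous_pi fun y => (S.rightTranslate y f).continuous)
  exact (continuous_subtype_val.comp h).subtype_mk _

theorem totallyBounded_range_translateAP (f : S.AP) :
    TotallyBounded (range fun s => S.translateAP s f) := by
  have h : TotallyBounded (range fun s => S.leftTranslate s f) :=
    (S.mem_AP_iff_left.1 f.2).totallyBounded.subset subset_closure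
  refine (totallyBounded_preimage isUniformEmbedding_subtype_val.isUniformInducing h).subset ?_
  rintro _ ⟨s, rfl⟩
  exact ⟨s, rfl⟩

theorem integrable_leftTranslate (f : S.AP) (μ : Measure K) [IsFiniteMeasure μ] :
    Integrable (fun z => S.leftTranslate z f) μ := by
  borelize (K →ᵇ ℂ)
  have hcont : Continuous fun z => S.leftTranslate z f :=
    continuous_subtype_val.comp (S.continuous_translateAP_apply f)
  refine (integrable_const ‖(f : K →ᵇ ℂ)‖).mono' ?_
    (.of_forall fun z => S.norm_leftTranslate_le z f)
  exact aestronglyMeasurable_iff_aemeasurable_separable.2 ⟨hcont.aemeasurable, _,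
    (S.mem_AP_iff_left.1 f.2).isSeparable, .of_forall fun z => subset_closure ⟨z, rfl⟩⟩

theorem integral_leftTranslate (f : S.AP) (s t : K) :
    ∫ z, S.leftTranslate z f ∂(S.pp s t) = S.leftTranslate t (S.leftTranslate s f) := by
  ext y
  rw [S.leftTranslate_leftTranslate_apply]
  exact ((BoundedContinuousFunction.evalCLM ℂ y).integral_comp_comm
    (S.integrable_leftTranslate f (S.pp s t))).symm

theorem hasWeakIntegral_translateAP (f : S.AP) (s t : K) :
    HasWeakIntegral ℂ (S.pp s t) (fun z => S.translateAP z f)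
      (S.translateAP t (S.translateAP s f)) := by
  intro φ
  obtain ⟨ψ, hψ, -⟩ := exists_extension_norm_eq S.AP φ
  have hφ (g : S.AP) : φ g = ψ g := (hψ g).symm
  simp only [hφ]
  refine ⟨ψ.integrable_comp (S.integrable_leftTranslate f (S.pp s t)), ?_⟩
  exact (ψ.integral_comp_comm (S.integrable_leftTranslate f (S.pp s t))).trans
    (congrArg ψ (S.integral_leftTranslate f s t))

end SemitopologicalSemihypergroup

/-! ### Fixed points from an invariant mean -/

section Means

variable {X : Type*} [TopologicalSpace X] {V : Submodule ℂ (X →ᵇ ℂ)}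

/-- Evaluation at `x`, as a functional on the function space `V`. -/
noncomputable def evalFunctional (V : Submodule ℂ (X →ᵇ ℂ)) (x : X) : WeakDual ℂ V :=
  StrongDual.toWeakDual ((BoundedContinuousFunction.evalCLM ℂ x).comp V.subtypeL)

theorem norm_sub_smul_one_le_sqrt {f : X →ᵇ ℂ} {c t : ℝ} (hf : ∀ x, |(f x).re - c| ≤ t) :
    ‖f - (c : ℂ) • 1‖ ≤ √(t ^ 2 + ‖f‖ ^ 2) := by
  rw [BoundedContinuousFunction.norm_le (Real.sqrt_nonneg _)]
  refine fun x => Real.le_sqrt_of_sq_le ?_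
  have him : |(f x).im| ≤ ‖f‖ := (Complex.abs_im_le_norm _).trans (f.norm_coe_le_norm x)
  calc ‖f x - c * 1‖ ^ 2 = |(f x).re - c| ^ 2 + |(f x).im| ^ 2 := by
        simp [Complex.sq_norm, Complex.normSq_apply, ← sq]
    _ ≤ t ^ 2 + ‖f‖ ^ 2 := by gcongr; exact hf x

theorem re_apply_le_of_forall_re_le {m : V →L[ℂ] ℂ} (hm : ‖m‖ ≤ 1) {e : V}
    (he : (e : X →ᵇ ℂ) = 1) (hme : m e = 1) {f : V} {r : ℝ}
    (hf : ∀ x, ((f : X →ᵇ ℂ) x).re ≤ r) : (m f).re ≤ r := by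
  -- The half-plane `re ≤ r` is a union of growing disks; `t` is the radius of one large enough.
  by_contra! hlt
  set δ := (m f).re - r with hδ
  have hδ0 : 0 < δ := sub_pos.2 hlt
  set t := ‖f‖ + |r| + ‖f‖ ^ 2 / δ with ht
  have hbound (x : X) : |((f : X →ᵇ ℂ) x).re - (r - t)| ≤ t := by
    have hre := abs_le.1 ((Complex.abs_re_le_norm _).trans ((f : X →ᵇ ℂ).norm_coe_le_norm x))
    have hr := abs_le.1 (le_refl |r|)
    have hq : 0 ≤ ‖f‖ ^ 2 / δ := by positivity
    rw [abs_le]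
    change -‖f‖ ≤ _ ∧ _ ≤ ‖f‖ at hre
    constructor <;> linarith [hf x]
  have hnorm : t + δ ≤ √(t ^ 2 + ‖f‖ ^ 2) :=
    calc t + δ = (m (f - ((r - t : ℝ) : ℂ) • e)).re := by simp [hme, hδ]; ring
      _ ≤ ‖m (f - ((r - t : ℝ) : ℂ) • e)‖ := Complex.re_le_norm _
      _ ≤ ‖f - ((r - t : ℝ) : ℂ) • e‖ := (m.le_of_opNorm_le hm _).trans_eq (one_mul _)
      _ = ‖(f : X →ᵇ ℂ) - ((r - t : ℝ) : ℂ) • 1‖ := by rw [← he]; rfl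
      _ ≤ √(t ^ 2 + ‖f‖ ^ 2) := norm_sub_smul_one_le_sqrt hbound
  have ht0 : 0 ≤ t := by positivity
  have hsq : (t + δ) ^ 2 ≤ t ^ 2 + ‖f‖ ^ 2 :=
    (Real.le_sqrt' (add_pos_of_nonneg_of_pos ht0 hδ0)).1 hnorm
  have htδ : ‖f‖ ^ 2 ≤ t * δ := by
    rw [ht, add_mul, div_mul_cancel₀ _ hδ0.ne']
    exact le_add_of_nonneg_left (by positivity)
  nlinarith

theorem mem_closure_of_forall_evalFunctional_mem {m : WeakDual ℂ V}
    (hm : ‖WeakDual.toStrongDual m‖ ≤ 1) {e : V} (he : (e : X →ᵇ ℂ) = 1) (hme : m e = 1)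
    {A : Set (WeakDual ℂ V)} (hA : Convex ℝ A) (hmem : ∀ x, evalFunctional V x ∈ A) :
    m ∈ closure A := by
  by_contra hmA
  obtain ⟨f, r, hf, hr⟩ := exists_re_lt_of_notMem_closure_weakDual hA hmA
  exact hr.not_ge (re_apply_le_of_forall_re_le hm he hme fun x => (hf _ (hmem x)).le)

end Means

theorem IsEquicontinuousAction.equicontinuous_comp {K C α : Type*} [TopologicalSpace C]
    [UniformSpace α] {π : K → C → C} (heq : IsEquicontinuousAction π) {h : C → α}
    (hh : Continuous h) : Equicontinuous fun s x => h (π s x) := by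
  intro x W hW
  have hmaps : MapsTo (Prod.map h h) (diagonal C) (diagonal α) := fun _ hq => congrArg h hq
  obtain ⟨V, hV, hVW⟩ := heq x _
    ((hh.prodMap hh).tendsto_nhdsSet hmaps (nhdsSet_diagonal_le_uniformity hW))
  have hVx : {y | (x, y) ∈ V} ∈ 𝓝 x :=
    (Continuous.prodMk_right x).continuousAt.preimage_mem_nhds
      (mem_nhdsSet_iff_forall.1 hV (x, x) rfl)
  exact mem_of_superset hVx hVW

section OrbitFunction

variable {K C : Type*} [TopologicalSpace K] [TopologicalSpace C] [CompactSpace C]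
  {π : K → C → C} (hπ : ∀ x, Continuous fun s => π s x)

/-- The function `s ↦ h (π s x)` describing the observable `h` along the orbit of `x`. -/
noncomputable def orbitFunction (h : C(C, ℂ)) (x : C) : K →ᵇ ℂ :=
  (BoundedContinuousFunction.mkOfCompact h).compContinuous ⟨fun s => π s x, hπ x⟩

theorem continuous_orbitFunction (heq : IsEquicontinuousAction π) (h : C(C, ℂ)) :
    Continuous (orbitFunction hπ h) :=
  continuous_iff_continuousAt.2 fun x =>
    BoundedContinuousFunction.tendsto_iff_tendstoUniformly.2
      (heq.equicontinuous_comp h.continuous x)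

end OrbitFunction

section Barycenter

variable {𝕜 : Type*} [RCLike 𝕜] {E : Type*} [AddCommGroup E] [Module 𝕜 E] [TopologicalSpace E]
  {C : Set E}

/-- The real part of a functional on `E`, as a complex-valued observable on `C`. -/
noncomputable def reOn (C : Set E) (φ : E →L[𝕜] 𝕜) : C(C, ℂ) where
  toFun x := (RCLike.re (φ x) : ℝ)

theorem eq_of_forall_reOn_eq [Module ℝ E] [IsScalarTower ℝ 𝕜 E] [IsTopologicalAddGroup E]
    [ContinuousSMul 𝕜 E] [LocallyConvexSpace ℝ E] [T1Space E] {x y : C}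
    (h : ∀ φ : E →L[𝕜] 𝕜, reOn C φ x = reOn C φ y) : x = y := by
  have : ContinuousSMul ℝ E := IsScalarTower.continuousSMul 𝕜
  by_contra hxy
  obtain ⟨φ, hφ⟩ := RCLike.geometric_hahn_banach_point_point (𝕜 := 𝕜) (Subtype.coe_ne_coe.2 hxy)
  exact hφ.ne (Complex.ofReal_injective (h φ))

variable {K : Type*} [TopologicalSpace K] [T2Space K] [LocallyCompactSpace K] [MeasurableSpace K]
  [BorelSpace K] {S : SemitopologicalSemihypergroup K} {π : K → C → C}

theorem IsAction.integral_reOn (hact : IsAction 𝕜 S π) (φ : E →L[𝕜] 𝕜) (s t : K) (x : C) :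
    ∫ z, reOn C φ (π z x) ∂(S.pp s t) = reOn C φ (π s (π t x)) := by
  obtain ⟨hint, hval⟩ := hact.integral s t x φ
  let L : 𝕜 →L[ℝ] ℂ := Complex.ofRealCLM.comp RCLike.reCLM
  exact (L.integral_comp_comm hint).trans (congrArg L hval)

section OrbitFunction

variable [CompactSpace C] (hπ : ∀ x, Continuous fun s => π s x)

theorem rightTranslate_orbitFunction (hact : IsAction 𝕜 S π) (φ : E →L[𝕜] 𝕜) (x : C) (t : K) :
    S.rightTranslate t (orbitFunction hπ (reOn C φ) x)
      = orbitFunction hπ (reOn C φ) (π t x) := by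
  ext s
  exact hact.integral_reOn φ s t x

theorem orbitFunction_mem_AP (hact : IsAction 𝕜 S π) (heq : IsEquicontinuousAction π)
    (φ : E →L[𝕜] 𝕜) (x : C) : orbitFunction hπ (reOn C φ) x ∈ S.AP := by
  rw [S.mem_AP_iff_right]
  have hc := isCompact_range (continuous_orbitFunction hπ heq (reOn C φ))
  refine hc.of_isClosed_subset isClosed_closure (closure_minimal ?_ hc.isClosed)
  rintro _ ⟨t, rfl⟩
  exact ⟨π t x, (rightTranslate_orbitFunction hπ hact φ x t).symm⟩

end OrbitFunction

/-- The pairs `(G, y)` such that `G`, tested on the functions `F φ` and on their translates, acts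
like the evaluation of `φ` at `y` and at the points `π t y`. When `F φ` is the orbit function of
`re φ` at `x`, this says that `y` is the barycenter of the image of `G` under `s ↦ π s x`, and that
each `π t` respects it. -/
def barycenterGraph (π : K → C → C) (F : (E →L[𝕜] 𝕜) → S.AP) : Set (WeakDual ℂ S.AP × C) :=
  {q | ∀ φ, q.1 (F φ) = reOn C φ q.2 ∧ ∀ t, q.1 (S.translateAP t (F φ)) = reOn C φ (π t q.2)}

variable {F : (E →L[𝕜] 𝕜) → S.AP}

theorem isClosed_barycenterGraph (hπ : ∀ s, Continuous fun x => π s x) :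
    IsClosed (barycenterGraph π F) := by
  have heval (f : S.AP) : Continuous fun q : WeakDual ℂ S.AP × C => q.1 f :=
    (WeakDual.eval_continuous f).comp continuous_fst
  simp only [barycenterGraph, ofPred_forall, ofPred_and]
  refine isClosed_iInter fun φ => (isClosed_eq (heval _) (by fun_prop)).inter <|
    isClosed_iInter fun t => isClosed_eq (heval _) ?_
  exact (reOn C φ).continuous.comp ((hπ t).comp continuous_snd)

theorem convex_fst_image_barycenterGraph [Module ℝ E] [IsScalarTower ℝ 𝕜 E] (hC : Convex ℝ C)
    (haff : IsAffineAction π) : Convex ℝ (Prod.fst '' barycenterGraph π F) := by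
  have hre {y y₁ y₂ : C} {a b : ℝ} (h : (y : E) = a • (y₁ : E) + b • (y₂ : E)) (φ : E →L[𝕜] 𝕜) :
      reOn C φ y = a • reOn C φ y₁ + b • reOn C φ y₂ := by
    simp [reOn, h, RCLike.smul_re]
  rintro _ ⟨⟨G₁, y₁⟩, h₁, rfl⟩ _ ⟨⟨G₂, y₂⟩, h₂, rfl⟩ a b ha hb hab
  let y : C := ⟨a • y₁ + b • y₂, hC y₁.2 y₂.2 ha hb hab⟩
  refine ⟨(a • G₁ + b • G₂, y), fun φ => ⟨?_, fun t => ?_⟩, rfl⟩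
  · change a • G₁ (F φ) + b • G₂ (F φ) = reOn C φ y
    rw [hre rfl, (h₁ φ).1, (h₂ φ).1]
  · change a • G₁ (S.translateAP t (F φ)) + b • G₂ (S.translateAP t (F φ)) = reOn C φ (π t y)
    rw [hre (haff t y₁ y₂ y a b ha hb hab rfl), (h₁ φ).2, (h₂ φ).2]

theorem evalFunctional_mem_fst_image_barycenterGraph (hact : IsAction 𝕜 S π) {x : C}
    (hF : ∀ φ s, (F φ : K →ᵇ ℂ) s = reOn C φ (π s x)) (s : K) :
    evalFunctional S.AP s ∈ Prod.fst '' barycenterGraph π F := by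
  refine ⟨(_, π s x), fun φ => ⟨hF φ s, fun t => ?_⟩, rfl⟩
  refine Eq.trans ?_ (hact.integral_reOn φ t s x)
  exact integral_congr_ae (.of_forall fun z => hF φ z)

theorem SemitopologicalSemihypergroup.IsMean.exists_mem_barycenterGraph [Module ℝ E]
    [IsScalarTower ℝ 𝕜 E] {m : S.AP →L[ℂ] ℂ} (hm : S.IsMean m) [CompactSpace C]
    (hC : Convex ℝ C) (hact : IsAction 𝕜 S π) (hπ : ∀ s, Continuous fun x => π s x)
    (haff : IsAffineAction π) {x : C} (hF : ∀ φ s, (F φ : K →ᵇ ℂ) s = reOn C φ (π s x)) :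
    ∃ y, (StrongDual.toWeakDual m, y) ∈ barycenterGraph π F := by
  have hclosed : IsClosed (Prod.fst '' barycenterGraph π F) :=
    isClosedMap_fst_of_compactSpace _ (isClosed_barycenterGraph hπ)
  have hmem := mem_closure_of_forall_evalFunctional_mem (m := StrongDual.toWeakDual m) hm.1.le rfl
    hm.2 (convex_fst_image_barycenterGraph hC haff)
    (evalFunctional_mem_fst_image_barycenterGraph hact hF)
  obtain ⟨⟨_, y⟩, hy, rfl⟩ := hclosed.closure_subset hmem
  exact ⟨y, hy⟩

end Barycenter

theorem fixedPointProperty_of_leftAmenableAP {K : Type u} [TopologicalSpace K]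
    [T2Space K] [LocallyCompactSpace K] [MeasurableSpace K] [BorelSpace K]
    {S : SemitopologicalSemihypergroup K} {𝕜 : Type} [RCLike 𝕜] (hS : S.LeftAmenableAP) :
    FixedPointProperty.{u, v} 𝕜 S := by
  intro E _ _ _ _ _ _ _ _ _ C hne hcpt hC π hact hsep heq haff
  have : CompactSpace C := isCompact_iff_compactSpace.1 hcpt
  obtain ⟨m, hm, hinv⟩ := hS
  obtain ⟨x⟩ := hne.to_subtype
  let F (φ : E →L[𝕜] 𝕜) : S.AP :=
    ⟨orbitFunction hsep.2 (reOn C φ) x, orbitFunction_mem_AP hsep.2 hact heq φ x⟩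
  obtain ⟨y, hy⟩ := hm.exists_mem_barycenterGraph (F := F) hC hact hsep.1 haff fun _ _ => rfl
  refine ⟨y, fun t => eq_of_forall_reOn_eq (𝕜 := 𝕜) fun φ => ?_⟩
  calc reOn C φ (π t y) = m (S.translateAP t (F φ)) := ((hy φ).2 t).symm
    _ = m (F φ) := hinv t _ _ rfl
    _ = reOn C φ y := (hy φ).1

/-! ### The action on the means -/

theorem isEquicontinuousAction_of_equicontinuous {K C : Type*} [UniformSpace C] [CompactSpace C]
    {π : K → C → C} (h : Equicontinuous π) : IsEquicontinuousAction π := by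
  intro x U hU
  rw [nhdsSet_diagonal_eq_uniformity] at hU ⊢
  exact ⟨_, CompactSpace.uniformEquicontinuous_of_equicontinuous h U hU, fun y hy s => hy s⟩

theorem equicontinuous_of_totallyBounded_range {P A α ι : Type*} [TopologicalSpace P]
    [PseudoMetricSpace A] [PseudoMetricSpace α] {F : P → A → α} (hlip : ∀ p, LipschitzWith 1 (F p))
    (hcont : ∀ a, Continuous fun p => F p a) {g : ι → A} (hg : TotallyBounded (range g)) :
    Equicontinuous fun i p => F p (g i) := by
  intro p₀
  refine Metric.equicontinuousAt_iff_right.2 fun ε hε => ?_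
  obtain ⟨J, hJ⟩ := exists_finite_net hg (show 0 < ε / 3 by positivity)
  have hnet : ∀ᶠ p in 𝓝 p₀, ∀ j ∈ J, dist (F p₀ (g j)) (F p (g j)) < ε / 3 :=
    (Finset.eventually_all J).2 fun j _ => by
      simp only [dist_comm (F p₀ (g j))]
      exact Metric.tendsto_nhds.1 ((hcont (g j)).tendsto p₀) _ (by positivity)
  filter_upwards [hnet] with p hp i
  obtain ⟨j, hj, hij⟩ := hJ i
  have hle (q : P) : dist (F q (g i)) (F q (g j)) < ε / 3 :=
    ((hlip q).dist_le_mul _ _).trans_lt (by simpa using hij)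
  calc dist (F p₀ (g i)) (F p (g i))
      ≤ dist (F p₀ (g i)) (F p₀ (g j)) + dist (F p₀ (g j)) (F p (g j))
        + dist (F p (g j)) (F p (g i)) := dist_triangle4 ..
    _ < ε / 3 + ε / 3 + ε / 3 := by
        rw [dist_comm (F p (g j))]
        exact add_lt_add (add_lt_add (hle p₀) (hp j hj)) (hle p)
    _ = ε := by ring

theorem hasWeakIntegral_pi {X ι 𝕜 : Type*} [RCLike 𝕜] [MeasurableSpace X] {μ : Measure X}
    {f : X → ι → 𝕜} {v : ι → 𝕜}
    (h : ∀ i, Integrable (fun x => f x i) μ ∧ ∫ x, f x i ∂μ = v i) :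
    HasWeakIntegral 𝕜 μ f v := by
  intro φ
  have hspan : (φ : (ι → 𝕜) →ₗ[𝕜] 𝕜) ∈ Submodule.span 𝕜 (range fun i : ι => LinearMap.proj i) :=
    (LinearMap.mem_span_iff_continuous _).2 φ.continuous
  refine Submodule.span_induction
    (p := fun ψ _ => Integrable (fun x => ψ (f x)) μ ∧ ∫ x, ψ (f x) ∂μ = ψ v) ?_ ?_ ?_ ?_ hspan
  · rintro _ ⟨i, rfl⟩
    exact h i
  · simp
  · rintro ψ χ - - ⟨hψ, hψv⟩ ⟨hχ, hχv⟩
    exact ⟨hψ.add hχ, (integral_add hψ hχ).trans (congrArg₂ _ hψv hχv)⟩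
  · rintro c ψ - ⟨hψ, hψv⟩
    exact ⟨hψ.smul c, (integral_smul c _).trans (congrArg _ hψv)⟩

namespace SemitopologicalSemihypergroup

variable {K : Type u} [TopologicalSpace K] [T2Space K] [LocallyCompactSpace K] [MeasurableSpace K]
  [BorelSpace K] {S : SemitopologicalSemihypergroup K}

theorem isMean_iff {m : S.AP →L[ℂ] ℂ} :
    S.IsMean m ↔ (∀ f, ‖m f‖ ≤ ‖f‖) ∧ m ⟨1, S.one_mem_AP⟩ = 1 := by
  have hball : ‖m‖ ≤ 1 ↔ ∀ f, ‖m f‖ ≤ ‖f‖ := by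
    simpa only [one_mul] using ContinuousLinearMap.opNorm_le_iff zero_le_one
  rw [← hball]
  refine and_congr_left fun hm => ⟨le_of_eq, fun h => h.antisymm ?_⟩
  have hone : ‖(⟨1, S.one_mem_AP⟩ : S.AP)‖ ≤ 1 :=
    (BoundedContinuousFunction.norm_le (f := (1 : K →ᵇ ℂ)) zero_le_one).2 fun _ => by simp
  calc 1 = ‖m ⟨1, S.one_mem_AP⟩‖ := by rw [hm, norm_one]
    _ ≤ ‖m‖ := m.unit_le_opNorm _ hone

theorem isMean_evalFunctional (x : K) :
    S.IsMean (WeakDual.toStrongDual (evalFunctional S.AP x)) :=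
  isMean_iff.2 ⟨fun f => (f : K →ᵇ ℂ).norm_coe_le_norm x, rfl⟩

theorem IsMean.comp_translateAP {m : S.AP →L[ℂ] ℂ} (hm : S.IsMean m) (s : K) :
    S.IsMean (m.comp (S.translateAP s)) := by
  rw [isMean_iff] at hm ⊢
  refine ⟨fun f => (hm.1 _).trans (S.norm_leftTranslate_le s f), ?_⟩
  exact (congrArg m (Subtype.ext (S.leftTranslate_one s))).trans hm.2

theorem IsIdentity.translateAP_eq {e : K} (he : S.IsIdentity e) (f : S.AP) :
    S.translateAP e f = f := by
  refine Subtype.ext (BoundedContinuousFunction.ext fun y => ?_)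
  change ∫ z, (f : K →ᵇ ℂ) z ∂(S.pp e y) = _
  rw [(he y).2, integral_dirac]

variable (S) in
/-- The set of means on `AP(K)`, in the weak dual. -/
def means : Set (WeakDual ℂ S.AP) := {m | S.IsMean (WeakDual.toStrongDual m)}

theorem isCompact_means : IsCompact S.means := by
  refine (WeakDual.isCompact_closedBall (𝕜 := ℂ) (0 : StrongDual ℂ S.AP) 1).of_isClosed_subset ?_
    fun m hm => mem_closedBall_zero_iff.2 hm.1.le
  simp only [means, isMean_iff, ofPred_and, ofPred_forall]
  refine .inter (isClosed_iInter fun f => ?_) ?_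
  · exact isClosed_le (WeakDual.eval_continuous f).norm continuous_const
  · exact isClosed_eq (WeakDual.eval_continuous _) continuous_const

theorem convex_means : Convex ℝ S.means := by
  intro m hm n hn a b ha hb hab
  rw [means, mem_ofPred_eq, isMean_iff] at hm hn ⊢
  refine ⟨fun f => ?_, ?_⟩
  · exact mem_closedBall_zero_iff.1 <| convex_closedBall (0 : ℂ) ‖f‖
      (mem_closedBall_zero_iff.2 (hm.1 f)) (mem_closedBall_zero_iff.2 (hn.1 f)) ha hb hab
  · change a • WeakDual.toStrongDual m _ + b • WeakDual.toStrongDual n _ = 1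
    rw [hm.2, hn.2, ← add_smul, hab, one_smul]

variable (S) in
/-- The map sending a functional `m` on `AP(K)` to the coordinates `(re m(f))_f`. The index set is
lifted, and the coordinates are viewed in `𝕜`, so that the target is a locally convex space over
`𝕜` in the required universe. -/
noncomputable def realCoords (𝕜 : Type*) [RCLike 𝕜] :
    WeakDual ℂ S.AP →ₗ[ℝ] (ULift.{v} S.AP → 𝕜) where
  toFun m f := ((m f.down).re : ℝ)
  map_add' m n := by
    ext f
    change (((m f.down + n f.down).re : ℝ) : 𝕜) = _
    simp
  map_smul' c m := by
    ext f
    change (((c • m f.down).re : ℝ) : 𝕜) = _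
    simp [RCLike.real_smul_eq_coe_mul]

variable {𝕜 : Type*} [RCLike 𝕜]

theorem continuous_realCoords : Continuous (S.realCoords.{u, v} 𝕜) :=
  continuous_pi fun f => RCLike.continuous_ofReal.comp
    (Complex.continuous_re.comp (WeakDual.eval_continuous f.down))

theorem lipschitzWith_realCoords {m : WeakDual ℂ S.AP} (hm : m ∈ S.means) :
    LipschitzWith 1 fun f : S.AP => S.realCoords.{u, v} 𝕜 m ⟨f⟩ := by
  refine LipschitzWith.of_dist_le_mul fun f g => ?_
  rw [NNReal.coe_one, one_mul, dist_eq_norm, dist_eq_norm]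
  calc ‖(((m f).re : ℝ) : 𝕜) - (((m g).re : ℝ) : 𝕜)‖ = |(m (f - g)).re| := by
        rw [map_sub, Complex.sub_re, ← RCLike.ofReal_sub, RCLike.norm_ofReal]
    _ ≤ ‖m (f - g)‖ := Complex.abs_re_le_norm _
    _ ≤ ‖f - g‖ := (isMean_iff.1 hm).1 _

variable (S) in
/-- The means on `AP(K)`, given by the real parts of their coordinates. -/
def meanSet (𝕜 : Type*) [RCLike 𝕜] : Set (ULift.{v} S.AP → 𝕜) := S.realCoords 𝕜 '' S.means

theorem isCompact_meanSet : IsCompact (S.meanSet.{u, v} 𝕜) :=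
  isCompact_means.image continuous_realCoords

theorem convex_meanSet : Convex ℝ (S.meanSet.{u, v} 𝕜) := by
  rintro _ ⟨m, hm, rfl⟩ _ ⟨n, hn, rfl⟩ a b ha hb hab
  exact ⟨a • m + b • n, convex_means hm hn ha hb hab, by rw [map_add, map_smul, map_smul]⟩

theorem nonempty_meanSet [Nonempty K] : (S.meanSet.{u, v} 𝕜).Nonempty :=
  Nonempty.image _ ⟨_, isMean_evalFunctional (Classical.arbitrary K)⟩

variable (S) in
/-- The action of `K` on the means dual to left translation. -/
noncomputable def meanAction (𝕜 : Type*) [RCLike 𝕜] (s : K) (g : S.meanSet.{u, v} 𝕜) :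
    S.meanSet.{u, v} 𝕜 :=
  ⟨fun f => g.1 ⟨S.translateAP s f.down⟩, by
    obtain ⟨m, hm, hg⟩ := g.2
    exact ⟨StrongDual.toWeakDual ((WeakDual.toStrongDual m).comp (S.translateAP s)),
      IsMean.comp_translateAP hm s, by rw [← hg]; rfl⟩⟩

theorem isAction_meanAction : IsAction 𝕜 S (S.meanAction.{u, v} 𝕜) where
  integral s t g := by
    obtain ⟨m, -, hm⟩ := g.2
    let L : ℂ →L[ℝ] 𝕜 := RCLike.ofRealCLM.comp Complex.reCLM
    refine hasWeakIntegral_pi fun f => ?_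
    obtain ⟨hint, hval⟩ := S.hasWeakIntegral_translateAP f.down s t (WeakDual.toStrongDual m)
    change Integrable (fun z => g.1 ⟨S.translateAP z f.down⟩) _ ∧
      ∫ z, g.1 ⟨S.translateAP z f.down⟩ ∂(S.pp s t) =
        g.1 ⟨S.translateAP t (S.translateAP s f.down)⟩
    rw [← hm]
    exact ⟨L.integrable_comp hint, (L.integral_comp_comm hint).trans (congrArg L hval)⟩
  identity e he g := Subtype.ext <| funext fun f => congrArg (fun k => g.1 ⟨k⟩)
    (he.translateAP_eq f.down)

theorem isSeparatelyContinuous_meanAction :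
    IsSeparatelyContinuous (S.meanAction.{u, v} 𝕜) := by
  refine ⟨fun s => .subtype_mk (continuous_pi fun f => ?_) _,
    fun g => .subtype_mk (continuous_pi fun f => ?_) _⟩
  · exact (continuous_apply _).comp continuous_subtype_val
  · obtain ⟨m, hm, hg⟩ := g.2
    rw [← hg]
    exact (lipschitzWith_realCoords hm).continuous.comp (S.continuous_translateAP_apply f.down)

theorem isAffineAction_meanAction : IsAffineAction (S.meanAction.{u, v} 𝕜) :=
  fun _ _ _ _ _ _ _ _ _ h => funext fun _ => congrFun h _

theorem equicontinuous_meanAction : Equicontinuous (S.meanAction.{u, v} 𝕜) := by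
  rw [isUniformEmbedding_subtype_val.isUniformInducing.equicontinuous_iff]
  refine (equicontinuous_iInf_rng (u := fun f : ULift.{v} S.AP =>
    UniformSpace.comap (fun g : ULift.{v} S.AP → 𝕜 => g f) inferInstance)).2 fun f => ?_
  have h : Equicontinuous fun (s : K) (g : S.meanSet.{u, v} 𝕜) => g.1 ⟨S.translateAP s f.down⟩ :=
    equicontinuous_of_totallyBounded_range
      (F := fun (g : S.meanSet.{u, v} 𝕜) (k : S.AP) => g.1 ⟨k⟩)
      (fun ⟨_, m, hm, hg⟩ => hg ▸ lipschitzWith_realCoords hm)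
      (fun k => (continuous_apply _).comp continuous_subtype_val)
      (S.totallyBounded_range_translateAP f.down)
  rintro g _ ⟨V, hV, hVU⟩
  exact (h g V hV).mono fun g' hg' s => hVU (hg' s)

theorem isLeftInvariant_of_re {m : S.AP →L[ℂ] ℂ}
    (h : ∀ s f, (m (S.translateAP s f)).re = (m f).re) : S.IsLeftInvariant m := by
  intro s f g hg
  obtain rfl : g = S.translateAP s f := Subtype.ext hg
  refine Complex.ext (h s f) ?_
  simpa using h s (Complex.I • f)

theorem leftAmenableAP_of_fixedPointProperty [Nonempty K]
    {𝕜 : Type} [RCLike 𝕜] (h : FixedPointProperty.{u, max u v} 𝕜 S) : S.LeftAmenableAP := by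
  have : CompactSpace (S.meanSet.{u, v} 𝕜) := isCompact_iff_compactSpace.1 isCompact_meanSet
  obtain ⟨⟨_, m, hm, rfl⟩, hfix⟩ := h (ULift.{v} S.AP → 𝕜) (S.meanSet.{u, v} 𝕜) nonempty_meanSet
    isCompact_meanSet convex_meanSet (S.meanAction 𝕜) isAction_meanAction
    isSeparatelyContinuous_meanAction
    (isEquicontinuousAction_of_equicontinuous equicontinuous_meanAction)
    isAffineAction_meanAction
  refine ⟨WeakDual.toStrongDual m, hm, isLeftInvariant_of_re fun s f => ?_⟩
  exact RCLike.ofReal_injective (congrFun (congrArg Subtype.val (hfix s)) ⟨f⟩)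

end SemitopologicalSemihypergroup

end SemiHyp

theorem theorem3p3 (𝕜 : Type) [RCLike 𝕜] {K : Type u} [Nonempty K] [TopologicalSpace K]
    [T2Space K] [LocallyCompactSpace K] [MeasurableSpace K] [BorelSpace K]
    (S : SemiHyp.SemitopologicalSemihypergroup K) :
    S.LeftAmenableAP ↔ SemiHyp.FixedPointProperty.{u, max u v} 𝕜 S :=
  ⟨SemiHyp.fixedPointProperty_of_leftAmenableAP,
    SemiHyp.SemitopologicalSemihypergroup.leftAmenableAP_of_fixedPointProperty⟩
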